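/- Let $\varphi:\mathbb R^n\to\mathbb R$ and $\Phi:\mathbb R^n\to\mathbb R^m$ be twice continuously differentiable, and let $g:\mathbb R^m\to(-\infty,\infty]$, $g\not\equiv\infty$, be convex piecewise linear-quadratic: $g$ is convex and $\operatorname{dom} g=\{z: g(z)<\infty\}$ is a finite union of polyhedral convex sets $C_i$ with $g(z)=\tfrac12\langle A_iz,z\rangle+\langle a_i,z\rangle+\alpha_i$ for all $z\in C_i$, where $A_i$ is symmetric, $a_i\in\mathbb R^m$, $\alpha_i\in\mathbb R$. For $r>0$ and $h:\mathbb R^m\to[-\infty,\infty]$ put $e_rh(y)=\inf_{z\in\mathbb R^m}\{h(z)+\tfrac1{2r}\|y-z\|^2\}$, and define, for $x\in\mathbb R^n$, $\lambda,\mu\in\mathbb R^m$, $\rho>0$, $$\mathscr L(x,\lambda,\rho)=\varphi(x)+e_{1/\rho}g\big(\Phi(x)+\rho^{-1}\lambda\big)-\tfrac12\rho^{-1}\|\lambda\|^2,\qquad L(x,\mu)=\varphi(x)+\langle\Phi(x),\mu\rangle .$$ For an extended-real-valued function $f$ finite at $\bar x$ and a vector $v$, let $$\Delta_t^2f(\bar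 x,v)(w)=\frac{f(\bar x+tw)-f(\bar x)-t\langle v,w\rangle}{\frac12t^2},\qquad \mathrm d^2f(\bar x,v)(w)=\liminf_{t\downarrow0,\ w'\to w}\Delta_t^2f(\bar x,v)(w').$$ The function $f$ is twice epi-differentiable at $\bar x$ for $v$ if $\operatorname{epi}\Delta^2_tf(\bar x,v)$ converges to $\operatorname{epi}\mathrm d^2f(\bar x,v)$ as $t\downarrow0$, where $C_t\to C$ means that $C$ is closed and $\operatorname{dist}(p,C_t)\to\operatorname{dist}(p,C)$ for every point $p$; then $\mathrm d^2f(\bar x,v)$ is its second-order epi-derivative. Let $\mathrm df(\bar x)(w)=\liminf_{t\downarrow0,\,w'\to w}\frac{f(\bar x+tw')-f(\bar x)}{t}$. The function $f$ is twice semidifferentiable at $\bar x$ if, for every $w$, both this $\liminf$ and $\liminf_{t\downarrow0,\,w'\to w}\frac{f(\bar x+tw')-f(\bar x)-t\,\mathrm df(\bar x)(w')}{\frac12t^2}$ are limits. **Theorem.** Let $\bar x\in\mathbb R^n$, $\lambda\in\mathbb R^m$ and $\rho>0$. The functions $e_{1/\rho}g$ and $x\mapsto\mathscr L(x,\lambda,\rho)$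 are finite everywhere, $e_{1/\rho}g$ is differentiable at $\Phi(\bar x)+\rho^{-1}\lambda$ and $x\mapsto\mathscr L(x,\lambda,\rho)$ is differentiable at $\bar x$. Put $\mu=\nabla(e_{1/\rho}g)(\Phi(\bar x)+\rho^{-1}\lambda)$ and $\bar v=\nabla_x\mathscr L(\bar x,\lambda,\rho)$. Then $x\mapsto\mathscr L(x,\lambda,\rho)$ is twice semidifferentiable at $\bar x$ and twice epi-differentiable at $\bar x$ for $\bar v$, and its second-order epi-derivative satisfies, for all $w\in\mathbb R^n$, $$\mathrm d_x^2\mathscr L\big((\bar x,\lambda,\rho),\bar v\big)(w)=\big\langle\nabla^2_{xx}L(\bar x,\mu)w,w\big\rangle+e_{1/(2\rho)}\Big(\mathrm d^2g\big(\Phi(\bar x)+\rho^{-1}(\lambda-\mu),\mu\big)\Big)\big(\nabla\Phi(\bar x)w\big),$$ where $\nabla\Phi(\bar x)$ denotes the Jacobian of $\Phi$ at $\bar x$. -/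

import Mathlib

open Filter Topology InnerProductSpace

namespace VarAnalysis

noncomputable section

section General

variable {E : Type*} [NormedAddCommGroup E] [InnerProductSpace ℝ E]

/-- The epigraph of an extended-real-valued function, as a subset of `E × ℝ` with the norm
`‖(w, u)‖ = √(‖w‖² + u²)`. -/
def epi (f : E → EReal) : Set (WithLp 2 (E × ℝ)) :=
  {p | f p.fst ≤ (p.snd : EReal)}

/-- The effective domain of an extended-real-valued function. -/
def effDom (f : E → EReal) : Set E := {x | f x < ⊤}

/-- Polyhedral convex sets: finite intersections of closed half-spaces. -/
def IsPolyhedral (C : Set E) : Prop :=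
  ∃ (k : ℕ) (b : Fin k → E) (β : Fin k → ℝ), C = {z | ∀ j, ⟪b j, z⟫_ℝ ≤ β j}

/-- Piecewise linear-quadratic functions: the domain is a finite union of polyhedral convex sets,
on each of which the function is a quadratic polynomial with symmetric quadratic part.
(In particular such a function never takes the value `⊥`.) -/
def IsPLQ (g : E → EReal) : Prop :=
  ∃ (s : ℕ) (C : Fin s → Set E) (A : Fin s → (E →ₗ[ℝ] E)) (a : Fin s → E) (α : Fin s → ℝ),
    (∀ i, IsPolyhedral (C i)) ∧ (∀ i, (A i).IsSymmetric) ∧ effDom g = ⋃ i, C i ∧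
    ∀ i, ∀ z ∈ C i, g z = ((1 / 2 * ⟪A i z, z⟫_ℝ + ⟪a i, z⟫_ℝ + α i : ℝ) : EReal)

/-- Convex piecewise linear-quadratic (CPLQ) functions. -/
def IsCPLQ (g : E → EReal) : Prop :=
  IsPLQ g ∧ Convex ℝ (epi g)

/-- The Moreau envelope `e_r g (y) = inf_z { g z + ‖y - z‖² / (2 r) }`, `r > 0`. -/
def moreauEnv (r : ℝ) (g : E → EReal) (y : E) : EReal :=
  ⨅ z : E, g z + ((1 / (2 * r) * ‖y - z‖ ^ 2 : ℝ) : EReal)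

/-- First-order difference quotient `(f (x + t w) - f x) / t`. -/
def diffQuot (f : E → EReal) (x : E) (t : ℝ) (w : E) : EReal :=
  (f (x + t • w) - f x) / (t : EReal)

/-- The filter of pairs `(t, w')` with `t ↓ 0` and `w' → w`. -/
def dirFilter (w : E) : Filter (ℝ × E) := 𝓝[>] (0 : ℝ) ×ˢ 𝓝 w

/-- The subderivative `df(x)(w)`. -/
def subderiv (f : E → EReal) (x w : E) : EReal :=
  liminf (fun p : ℝ × E => diffQuot f x p.1 p.2) (dirFilter w)

/-- Second-order difference quotient of `f` at `x` for `v`. -/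
def secondDiffQuot (f : E → EReal) (x v : E) (t : ℝ) (w : E) : EReal :=
  (f (x + t • w) - f x - ((t * ⟪v, w⟫_ℝ : ℝ) : EReal)) / ((1 / 2 * t ^ 2 : ℝ) : EReal)

/-- The second subderivative `d²f(x, v)(w)` of `f` at `x` for `v`. -/
def secondSubderiv (f : E → EReal) (x v w : E) : EReal :=
  liminf (fun p : ℝ × E => secondDiffQuot f x v p.1 p.2) (dirFilter w)

/-- Second-order difference quotient of `f` at `x` without mention of `v`. -/
def secondDiffQuotFree (f : E → EReal) (x : E) (t : ℝ) (w : E) : EReal :=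
  (f (x + t • w) - f x - (t : EReal) * subderiv f x w) / ((1 / 2 * t ^ 2 : ℝ) : EReal)

/-- The second subderivative `d²f(x)(w)` of `f` at `x`, without mention of `v`. -/
def secondSubderivFree (f : E → EReal) (x w : E) : EReal :=
  liminf (fun p : ℝ × E => secondDiffQuotFree f x p.1 p.2) (dirFilter w)

/-- `f` is finite at `x` and the lower limit defining `df(x)(w)` is a limit for every `w`. -/
def IsSemidifferentiableAt (f : E → EReal) (x : E) : Prop :=
  f x ≠ ⊥ ∧ f x ≠ ⊤ ∧
    ∀ w, Tendsto (fun p : ℝ × E => diffQuot f x p.1 p.2) (dirFilter w) (𝓝 (subderiv f x w))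

/-- `f` is semidifferentiable at `x` and the lower limit defining `d²f(x)(w)` is a limit for
every `w`. -/
def IsTwiceSemidifferentiableAt (f : E → EReal) (x : E) : Prop :=
  IsSemidifferentiableAt f x ∧
    ∀ w, Tendsto (fun p : ℝ × E => secondDiffQuotFree f x p.1 p.2) (dirFilter w)
      (𝓝 (secondSubderivFree f x w))

/-- Twice epi-differentiability of `f` at `x` for `v`: `f x` is finite and the epigraphs of the
second-order difference quotients converge to the epigraph of the second subderivative as
`t ↓ 0`. -/
def IsTwiceEpiDifferentiableAt (f : E → EReal) (x v : E) : Prop :=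
  f x ≠ ⊥ ∧ f x ≠ ⊤ ∧ IsClosed (epi (secondSubderiv f x v)) ∧
    ∀ p : WithLp 2 (E × ℝ),
      Tendsto (fun t : ℝ => Metric.infEDist p (epi (secondDiffQuot f x v t))) (𝓝[>] (0 : ℝ))
        (𝓝 (Metric.infEDist p (epi (secondSubderiv f x v))))

/-- The Hessian `∇²f(x)` of a real-valued function, as a linear operator. -/
def hessian [CompleteSpace E] (f : E → ℝ) (x : E) : E →L[ℝ] E :=
  fderiv ℝ (gradient f) x

end General

section Composite

variable {E F : Type*} [NormedAddCommGroup E] [InnerProductSpace ℝ E]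
  [NormedAddCommGroup F] [InnerProductSpace ℝ F]

/-- The Lagrangian `L(x, μ) = φ(x) + ⟨Φ(x), μ⟩`. -/
def lagrangian (φ : E → ℝ) (Φ : E → F) (x : E) (μ : F) : ℝ :=
  φ x + ⟪Φ x, μ⟫_ℝ

/-- The augmented Lagrangian `φ(x) + e_{1/ρ} g (Φ(x) + ρ⁻¹ lam) - ½ ρ⁻¹ ‖lam‖²`. -/
def augLagrangian (φ : E → ℝ) (Φ : E → F) (g : F → EReal) (x : E) (lam : F) (ρ : ℝ) : EReal :=
  (φ x : EReal) + moreauEnv (1 / ρ) g (Φ x + ρ⁻¹ • lam)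
    - ((1 / 2 * ρ⁻¹ * ‖lam‖ ^ 2 : ℝ) : EReal)

end Composite

end

end VarAnalysis

open VarAnalysis

/-! For every `y` the infimum defining `e_{1/ρ} g` is attained at a point `zbar`, and `ρ (y - zbar)`
is both a subgradient of `g` at `zbar` and the gradient `μ` of the envelope at `y`. Expanding the
square (`secondDiffQuot_add_prox_eq`) shows that the second-order quotient of the envelope at `u` is
exactly the infimum over `z` of the quotient of `g` at `zbar` for `μ` plus `ρ ‖u - z‖ ^ 2`. It
remains to pass to the limit under this infimum.

The lower bound uses compactness: the quotients of `g` are nonnegative, so far-away `z` are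
irrelevant. The upper bound uses the piecewise structure: `d²g` is recovered along fixed rays
(`IsPLQ.eventually_secondDiffQuot_le`). Together they give convergence with moving directions `u' →
u`.

The quotient of the augmented Lagrangian is the quotient of `L(·, μ)` plus that of the envelope in
the direction `(Φ(x + t w') - Φ(x)) / t`, with no remainder, so it converges in the same strong
sense. This implies twice semidifferentiability, epi-convergence and the formula at once. -/

namespace VarAnalysis

/-! ### Proximal points and the gradient of the Moreau envelope. -/

section Convex

variable {E : Type*} [NormedAddCommGroup E] [InnerProductSpace ℝ E]

theorem exists_real_of_ne_bot {a : EReal} (hbot : a ≠ ⊥) (htop : a < ⊤) : ∃ r : ℝ, a = r :=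
  ⟨a.toReal, (EReal.coe_toReal htop.ne hbot).symm⟩

theorem le_of_convex_epi {g : E → EReal} (hc : Convex ℝ (epi g)) {x y : E} {r s a b : ℝ}
    (hx : g x ≤ r) (hy : g y ≤ s) (ha : 0 ≤ a) (hb : 0 ≤ b) (hab : a + b = 1) :
    g (a • x + b • y) ≤ ((a * r + b * s : ℝ) : EReal) := by
  have hx' : (WithLp.toLp 2 (x, r)) ∈ epi g := hx
  have hy' : (WithLp.toLp 2 (y, s)) ∈ epi g := hy
  exact hc hx' hy' ha hb hab

theorem IsPolyhedral.isClosed {C : Set E} (hC : IsPolyhedral C) : IsClosed C := by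
  obtain ⟨k, b, β, rfl⟩ := hC
  simp only [Set.ofPred_forall]
  exact isClosed_iInter fun j => isClosed_le (by fun_prop) continuous_const

theorem IsPLQ.ne_bot {g : E → EReal} (hg : IsPLQ g) (z : E) : g z ≠ ⊥ := by
  obtain ⟨s, C, A, a, α, -, -, hdom, hq⟩ := hg
  by_cases hz : z ∈ effDom g
  · rw [hdom] at hz
    obtain ⟨i, hi⟩ := Set.mem_iUnion.1 hz
    rw [hq i z hi]
    exact EReal.coe_ne_bot _
  · have : g z = ⊤ := by simpa [effDom] using hz
    simp [this]

/-- A sublevel set below `⊤` is a finite union of polyhedra intersected with closed sublevel sets of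
quadratics. -/
theorem IsPLQ.lowerSemicontinuous [FiniteDimensional ℝ E] {g : E → EReal} (hg : IsPLQ g) :
    LowerSemicontinuous g := by
  obtain ⟨s, C, A, a, α, hC, -, hdom, hq⟩ := hg
  rw [lowerSemicontinuous_iff_isClosed_preimage]
  intro c
  rcases eq_or_ne c ⊤ with rfl | hc
  · simp
  have key : g ⁻¹' Set.Iic c = ⋃ i, C i ∩ {z | ((1 / 2 * ⟪A i z, z⟫_ℝ + ⟪a i, z⟫_ℝ + α i : ℝ) :
      EReal) ≤ c} := by
    ext z
    simp only [Set.mem_preimage, Set.mem_Iic, Set.mem_iUnion, Set.mem_inter_iff, Set.mem_ofPred_eq]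
    constructor
    · intro hz
      have : z ∈ effDom g := lt_of_le_of_lt hz hc.lt_top
      rw [hdom] at this
      obtain ⟨i, hi⟩ := Set.mem_iUnion.1 this
      exact ⟨i, hi, hq i z hi ▸ hz⟩
    · rintro ⟨i, hi, hz⟩
      rwa [hq i z hi]
  rw [key]
  refine isClosed_iUnion_of_finite fun i => (hC i).isClosed.inter ?_
  have hA : Continuous (A i) := (A i).continuous_of_finiteDimensional
  exact isClosed_le (continuous_coe_real_ereal.comp (by fun_prop)) continuous_const

/-- A proper lower semicontinuous convex function decreases at most linearly. -/
theorem exists_linear_minorant [FiniteDimensional ℝ E] {g : E → EReal}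
    (hc : Convex ℝ (epi g)) (hlsc : LowerSemicontinuous g) (hbot : ∀ z, g z ≠ ⊥)
    {z₀ : E} {c : ℝ} (hz₀ : g z₀ = c) :
    ∃ K : ℝ, 0 ≤ K ∧ ∀ (z : E) (s : ℝ), g z ≤ s → -(K * (1 + ‖z - z₀‖)) ≤ s := by
  obtain ⟨u, -, hu⟩ := (hlsc.lowerSemicontinuousOn (Metric.closedBall z₀ 1)).exists_isMinOn
    ⟨z₀, Metric.mem_closedBall_self zero_le_one⟩ (isCompact_closedBall z₀ 1)
  obtain ⟨M, hM⟩ := EReal.exists_between_coe_real (bot_lt_iff_ne_bot.2 (hbot u))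
  have hball : ∀ (z : E) (s : ℝ), ‖z - z₀‖ ≤ 1 → g z ≤ s → M ≤ s := by
    intro z s hz hs
    have h1 : g u ≤ g z := hu (by simpa [dist_eq_norm] using hz)
    exact EReal.coe_le_coe_iff.1 ((hM.2.le.trans h1).trans hs)
  refine ⟨|M| + |c|, by positivity, fun z s hs => ?_⟩
  have hd0 := norm_nonneg (z - z₀)
  have hM' := neg_abs_le M
  have hc' := le_abs_self c
  have hc0 := abs_nonneg c
  have hM0 := abs_nonneg M
  rcases le_or_gt ‖z - z₀‖ 1 with h | h
  · have := hball z s h hs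
    nlinarith [mul_nonneg (add_nonneg hM0 hc0) hd0]
  · set d := ‖z - z₀‖ with hd
    have hdpos : 0 < d := by linarith
    -- The point of the segment from `z₀` to `z` at distance 1 from `z₀` has value at least `M`;
    -- convexity carries this bound out to `z`.
    have h1 := le_of_convex_epi hc hz₀.le hs (a := 1 - d⁻¹) (b := d⁻¹)
      (sub_nonneg.2 (inv_le_one_of_one_le₀ h.le)) (by positivity) (by ring)
    have h2 : ‖((1 - d⁻¹) • z₀ + d⁻¹ • z) - z₀‖ ≤ 1 := by
      have : ((1 - d⁻¹) • z₀ + d⁻¹ • z) - z₀ = d⁻¹ • (z - z₀) := by module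
      rw [this, norm_smul, ← hd, Real.norm_of_nonneg (by positivity), inv_mul_cancel₀ hdpos.ne']
    have h3 := hball _ _ h2 h1
    have h4 : d * M ≤ (d - 1) * c + s := by
      have := mul_le_mul_of_nonneg_left h3 hdpos.le
      have e : d * ((1 - d⁻¹) * c + d⁻¹ * s) = (d - 1) * c + s := by
        field_simp
      linarith
    nlinarith [mul_le_mul_of_nonneg_left hM' hdpos.le,
      mul_le_mul_of_nonneg_left hc' (sub_nonneg.2 h.le)]

/-- `zbar` minimizes `z ↦ g z + ρ/2 ‖y - z‖²`, and `g zbar = r`. -/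
structure IsProxPoint (ρ : ℝ) (g : E → EReal) (y zbar : E) (r : ℝ) : Prop where
  eq : g zbar = r
  le : ∀ (z : E) (s : ℝ), g z ≤ s → r + ρ / 2 * ‖y - zbar‖ ^ 2 ≤ s + ρ / 2 * ‖y - z‖ ^ 2

theorem exists_isProxPoint [FiniteDimensional ℝ E] {g : E → EReal}
    (hc : Convex ℝ (epi g)) (hlsc : LowerSemicontinuous g) (hbot : ∀ z, g z ≠ ⊥)
    (hdom : (effDom g).Nonempty) {ρ : ℝ} (hρ : 0 < ρ) (y : E) :
    ∃ zbar r, IsProxPoint ρ g y zbar r := by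
  obtain ⟨z₀, hz₀⟩ := hdom
  obtain ⟨c, hc₀⟩ := exists_real_of_ne_bot (hbot z₀) hz₀
  obtain ⟨K, hK, hlin⟩ := exists_linear_minorant hc hlsc hbot hc₀
  set δ := ‖y - z₀‖ with hδ
  have hδ0 : 0 ≤ δ := norm_nonneg _
  -- Chosen so that for `‖z - z₀‖ > R` the quadratic penalty beats the linear minorant, and the
  -- objective is at least its value at `z₀`. A minimizer over the ball is then global.
  set R : ℝ := 1 + 2 * (ρ * δ + K + |K + c|) / ρ with hR
  have hR1 : 1 ≤ R := by
    have : 0 ≤ 2 * (ρ * δ + K + |K + c|) / ρ := by positivity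
    linarith
  have hlsc' : LowerSemicontinuous fun z => g z + ((ρ / 2 * ‖y - z‖ ^ 2 : ℝ) : EReal) := by
    refine hlsc.add' ?_ fun z => EReal.continuousAt_add (.inr (EReal.coe_ne_bot _)) (.inr (EReal.coe_ne_top _))
    exact (continuous_coe_real_ereal.comp (by fun_prop)).lowerSemicontinuous
  obtain ⟨u, -, hu⟩ := (hlsc'.lowerSemicontinuousOn (Metric.closedBall z₀ R)).exists_isMinOn
    ⟨z₀, Metric.mem_closedBall_self (by linarith)⟩ (isCompact_closedBall z₀ R)
  have hu0 := isMinOn_iff.1 hu z₀ (Metric.mem_closedBall_self (by linarith))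
  simp only [hc₀] at hu0
  have hutop : g u < ⊤ := by
    by_contra h
    rw [not_lt, top_le_iff] at h
    rw [h, EReal.top_add_coe, top_le_iff, ← EReal.coe_add] at hu0
    exact EReal.coe_ne_top _ hu0
  obtain ⟨r, hr⟩ := exists_real_of_ne_bot (hbot u) hutop
  refine ⟨u, r, hr, fun z s hs => ?_⟩
  rw [hr] at hu0
  norm_cast at hu0
  rcases le_or_gt ‖z - z₀‖ R with h | h
  · have h1 := isMinOn_iff.1 hu z (by simpa [dist_eq_norm] using h)
    have h2 := h1.trans (add_le_add_left hs _)
    rw [hr] at h2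
    exact_mod_cast h2
  · refine hu0.trans ?_
    have h1 := hlin z s hs
    set d := ‖z - z₀‖ with hd
    have h2 : d - δ ≤ ‖y - z‖ := by
      have := norm_sub_norm_le (z - z₀) (y - z₀)
      rwa [show z - z₀ - (y - z₀) = z - y by abel, norm_sub_rev z y] at this
    have h5 : ρ * R ≥ 2 * (ρ * δ + K + |K + c|) := by
      rw [hR]; field_simp; nlinarith
    have h6 := le_abs_self (K + c)
    have h7 := abs_nonneg (K + c)
    have h8 : ρ * R ≤ ρ * d := mul_le_mul_of_nonneg_left h.le hρ.le
    have hRδ : δ ≤ R := by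
      have : 2 * (ρ * δ) / ρ ≤ 2 * (ρ * δ + K + |K + c|) / ρ := by gcongr; linarith
      have e : 2 * (ρ * δ) / ρ = 2 * δ := by field_simp
      linarith
    have h3 : (d - δ) ^ 2 ≤ ‖y - z‖ ^ 2 := pow_le_pow_left₀ (by linarith) h2 2
    have h4 := mul_le_mul_of_nonneg_left h3 (by positivity : 0 ≤ ρ / 2)
    have h9 : 2 * (ρ * δ + K + |K + c|) * d ≤ ρ * d * d :=
      mul_le_mul_of_nonneg_right (by linarith) (by linarith)
    nlinarith [mul_le_mul_of_nonneg_left (show (1 : ℝ) ≤ d by linarith) h7]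

namespace IsProxPoint

variable {ρ : ℝ} {g : E → EReal} {y zbar : E} {r : ℝ}

theorem moreauEnv_eq (h : IsProxPoint ρ g y zbar r) (hbot : ∀ z, g z ≠ ⊥) :
    moreauEnv (1 / ρ) g y = ((r + ρ / 2 * ‖y - zbar‖ ^ 2 : ℝ) : EReal) := by
  have e : 1 / (2 * (1 / ρ)) = ρ / 2 := by
    rcases eq_or_ne ρ 0 with rfl | h <;> [simp; field_simp]
  unfold moreauEnv
  rw [e]
  refine le_antisymm ((iInf_le _ zbar).trans (by rw [h.eq, EReal.coe_add])) (le_iInf fun z => ?_)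
  by_cases hz : g z < ⊤
  · obtain ⟨s, hs⟩ := exists_real_of_ne_bot (hbot z) hz
    rw [hs]
    exact_mod_cast h.le z s hs.le
  · rw [not_lt, top_le_iff] at hz
    rw [hz, EReal.top_add_coe]
    exact le_top

theorem toReal_moreauEnv (h : IsProxPoint ρ g y zbar r) (hbot : ∀ z, g z ≠ ⊥) :
    (moreauEnv (1 / ρ) g y).toReal = r + ρ / 2 * ‖y - zbar‖ ^ 2 := by
  rw [h.moreauEnv_eq hbot, EReal.toReal_coe]

/-- `ρ (y - zbar)` is a subgradient of `g` at the proximal point `zbar`. -/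
theorem subgradient (h : IsProxPoint ρ g y zbar r) (hc : Convex ℝ (epi g)) {z : E}
    {s : ℝ} (hs : g z ≤ s) : r + ⟪ρ • (y - zbar), z - zbar⟫_ℝ ≤ s := by
  -- Compare `zbar` with `(1 - t) zbar + t z`, divide by `t`, then let `t ↓ 0`.
  have key : ∀ t ∈ Set.Ioo (0 : ℝ) 1,
      r + ⟪ρ • (y - zbar), z - zbar⟫_ℝ ≤ s + ρ / 2 * t * ‖z - zbar‖ ^ 2 := by
    rintro t ⟨ht0, ht1⟩
    have h1 := le_of_convex_epi hc h.eq.le hs (a := 1 - t) (b := t) (by linarith) ht0.le (by ring)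
    have h2 := h.le _ _ h1
    have e : y - ((1 - t) • zbar + t • z) = (y - zbar) - t • (z - zbar) := by module
    rw [e, norm_sub_sq_real (y - zbar), inner_smul_right, norm_smul, Real.norm_of_nonneg ht0.le] at h2
    rw [real_inner_smul_left]
    have h3 : t * (r + ρ * ⟪y - zbar, z - zbar⟫_ℝ) ≤ t * (s + ρ / 2 * t * ‖z - zbar‖ ^ 2) := by
      nlinarith
    exact le_of_mul_le_mul_left h3 ht0
  have hlim : Tendsto (fun t : ℝ => s + ρ / 2 * t * ‖z - zbar‖ ^ 2) (𝓝[>] 0) (𝓝 s) := by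
    have : Tendsto (fun t : ℝ => s + ρ / 2 * t * ‖z - zbar‖ ^ 2) (𝓝 0)
        (𝓝 (s + ρ / 2 * 0 * ‖z - zbar‖ ^ 2)) := by
      apply Continuous.tendsto; fun_prop
    simpa using this.mono_left nhdsWithin_le_nhds
  exact ge_of_tendsto hlim (eventually_of_mem (Ioo_mem_nhdsGT zero_lt_one) key)

/-- The Moreau envelope lies above its linearization and below a quadratic perturbation of it. -/
theorem moreauEnv_sub_bounds {y' zbar' : E} {r' : ℝ}
    (h : IsProxPoint ρ g y zbar r) (hρ : 0 < ρ) (hc : Convex ℝ (epi g))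
    (h' : IsProxPoint ρ g y' zbar' r') :
    0 ≤ (r' + ρ / 2 * ‖y' - zbar'‖ ^ 2) - (r + ρ / 2 * ‖y - zbar‖ ^ 2)
        - ⟪ρ • (y - zbar), y' - y⟫_ℝ ∧
      (r' + ρ / 2 * ‖y' - zbar'‖ ^ 2) - (r + ρ / 2 * ‖y - zbar‖ ^ 2)
        - ⟪ρ • (y - zbar), y' - y⟫_ℝ ≤ ρ / 2 * ‖y' - y‖ ^ 2 := by
  -- The subgradient inequality at `zbar'` gives the lower bound, with slack `ρ/2 ‖(y - zbar) - (y'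
  -- - zbar')‖²`; `zbar` as a competitor at `y'` gives the upper one.
  have h1 := h.subgradient hc h'.eq.le
  have h2 := h'.le zbar r h.eq.le
  have e1 : y' - zbar = (y - zbar) + (y' - y) := by abel
  have e2 : zbar' - zbar = (y - zbar) + (y' - y) - (y' - zbar') := by abel
  rw [e1, norm_add_sq_real] at h2
  rw [e2] at h1
  have h3 := sq_nonneg ‖(y - zbar) - (y' - zbar')‖
  rw [norm_sub_sq_real] at h3
  generalize y - zbar = p at *
  generalize y' - zbar' = q at *
  generalize y' - y = d at *
  simp only [real_inner_smul_left, inner_add_right, inner_sub_right,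
    real_inner_self_eq_norm_sq] at h1 ⊢
  constructor <;> nlinarith

/-- The sandwich makes the first-order remainder quadratic, so continuity of the proximal map is not
needed. -/
theorem hasGradientAt [CompleteSpace E] (h : IsProxPoint ρ g y zbar r) (hρ : 0 < ρ)
    (hc : Convex ℝ (epi g)) (hbot : ∀ z, g z ≠ ⊥)
    (hex : ∀ y, ∃ zbar r, IsProxPoint ρ g y zbar r) :
    HasGradientAt (fun y => (moreauEnv (1 / ρ) g y).toReal) (ρ • (y - zbar)) y := by
  rw [hasGradientAt_iff_isLittleO]
  have h1 : (fun x' => (moreauEnv (1 / ρ) g x').toReal - (moreauEnv (1 / ρ) g y).toReal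
      - ⟪ρ • (y - zbar), x' - y⟫_ℝ) =O[𝓝 y] fun x' => ‖x' - y‖ ^ 2 := by
    refine Asymptotics.IsBigO.of_bound (ρ / 2) (Eventually.of_forall fun x' => ?_)
    obtain ⟨z', r', h'⟩ := hex x'
    obtain ⟨b1, b2⟩ := h.moreauEnv_sub_bounds hρ hc h'
    rw [h'.toReal_moreauEnv hbot, h.toReal_moreauEnv hbot, Real.norm_of_nonneg b1,
      Real.norm_of_nonneg (by positivity)]
    exact b2
  refine h1.trans_isLittleO ?_
  have h2 : Tendsto (fun x' : E => x' - y) (𝓝 y) (𝓝 0) := by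
    have : Tendsto (fun x' : E => x' - y) (𝓝 y) (𝓝 (y - y)) := by
      apply Continuous.tendsto; fun_prop
    simpa using this
  simpa [Function.comp_def] using ((Asymptotics.isLittleO_pow_id (𝕜 := ℝ) (n := 2) (by norm_num)).comp_tendsto
    (by simpa using h2.norm : Tendsto (fun x' : E => ‖x' - y‖) (𝓝 y) (𝓝 0))).of_norm_right

end IsProxPoint

end Convex

/-! ### Second-order difference quotients at a subgradient. -/

section DiffQuot

variable {E : Type*} [NormedAddCommGroup E] [InnerProductSpace ℝ E]

instance dirFilter_neBot (w : E) : (dirFilter w).NeBot := by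
  unfold dirFilter; infer_instance

theorem tendsto_fst_dirFilter (w : E) : Tendsto Prod.fst (dirFilter w) (𝓝[>] (0 : ℝ)) :=
  tendsto_fst

theorem dirFilter_le_nhds (w : E) : dirFilter w ≤ 𝓝 ((0 : ℝ), w) := by
  rw [nhds_prod_eq]
  exact Filter.prod_mono nhdsWithin_le_nhds le_rfl

theorem eventually_pos_dirFilter (w : E) : ∀ᶠ p : ℝ × E in dirFilter w, 0 < p.1 :=
  (tendsto_fst_dirFilter w).eventually self_mem_nhdsWithin

theorem secondDiffQuot_coe {f : E → EReal} {x v w : E} {t r s : ℝ} (hx : f x = r)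
    (hw : f (x + t • w) = s) :
    secondDiffQuot f x v t w = (((s - r - t * ⟪v, w⟫_ℝ) / (1 / 2 * t ^ 2) : ℝ) : EReal) := by
  rw [secondDiffQuot, hx, hw, EReal.coe_div, EReal.coe_sub, EReal.coe_sub]

theorem lt_top_of_secondDiffQuot_lt {f : E → EReal} {x v w : E} {t r : ℝ} {c : EReal}
    (hx : f x = r) (ht : 0 < t) (h : secondDiffQuot f x v t w < c) : f (x + t • w) < ⊤ := by
  by_contra htop
  rw [not_lt, top_le_iff] at htop
  have hpos : (0 : EReal) < ((1 / 2 * t ^ 2 : ℝ) : EReal) := by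
    exact_mod_cast (by positivity : (0 : ℝ) < 1 / 2 * t ^ 2)
  rw [secondDiffQuot, hx, htop, EReal.top_sub_coe, EReal.top_sub_coe,
    EReal.top_div_of_pos_ne_top hpos (EReal.coe_ne_top _)] at h
  exact not_top_lt h

/-- This is the subgradient inequality rescaled. It later makes the penalized quotients coercive in
the direction. -/
theorem secondDiffQuot_nonneg {f : E → EReal} {x v : E} {r : ℝ} (hbot : ∀ z, f z ≠ ⊥)
    (hx : f x = r) (hsub : ∀ (z : E) (s : ℝ), f z ≤ s → r + ⟪v, z - x⟫_ℝ ≤ s)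
    {t : ℝ} (ht : 0 < t) (w : E) : 0 ≤ secondDiffQuot f x v t w := by
  by_contra h
  rw [not_le] at h
  obtain ⟨s, hs⟩ := exists_real_of_ne_bot (hbot _) (lt_top_of_secondDiffQuot_lt hx ht h)
  rw [secondDiffQuot_coe hx hs] at h
  have h1 := hsub _ s hs.le
  rw [add_sub_cancel_left, inner_smul_right] at h1
  have h2 : 0 ≤ (s - r - t * ⟪v, w⟫_ℝ) / (1 / 2 * t ^ 2) :=
    div_nonneg (by linarith) (by positivity)
  exact absurd h (not_lt.2 (by exact_mod_cast h2))

theorem secondSubderiv_nonneg {f : E → EReal} {x v : E} {r : ℝ} (hbot : ∀ z, f z ≠ ⊥)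
    (hx : f x = r) (hsub : ∀ (z : E) (s : ℝ), f z ≤ s → r + ⟪v, z - x⟫_ℝ ≤ s) (w : E) :
    0 ≤ secondSubderiv f x v w :=
  le_liminf_of_le (by isBoundedDefault)
    ((eventually_pos_dirFilter w).mono fun _ hp => secondDiffQuot_nonneg hbot hx hsub hp _)

end DiffQuot

/-! ### Recovery of the second subderivative along rays for piecewise linear-quadratic functions. -/

section Polyhedral

variable {E : Type*} [NormedAddCommGroup E] [InnerProductSpace ℝ E]

/-- A polyhedral convex set coincides along rays with its tangent cone, which is closed. -/
theorem IsPolyhedral.exists_tangentCone {C : Set E} (hC : IsPolyhedral C) {x : E} (hx : x ∈ C) :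
    ∃ T : Set E, IsClosed T ∧ (∀ t : ℝ, 0 < t → ∀ w, x + t • w ∈ C → w ∈ T) ∧
      ∀ w ∈ T, ∀ᶠ t in 𝓝[>] (0 : ℝ), x + t • w ∈ C := by
  obtain ⟨k, b, β, rfl⟩ := hC
  -- Only constraints active at `x` matter; the others persist for small `t` by continuity.
  refine ⟨{w | ∀ j, ⟪b j, x⟫_ℝ = β j → ⟪b j, w⟫_ℝ ≤ 0}, ?_, ?_, ?_⟩
  · simp only [Set.ofPred_forall]
    exact isClosed_iInter fun j => isClosed_iInter fun _ =>
      isClosed_le (by fun_prop) continuous_const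
  · intro t ht w hw j hj
    have := hw j
    rw [inner_add_right, inner_smul_right, hj] at this
    exact nonpos_of_mul_nonpos_right (by linarith) ht
  · intro w hw
    simp only [Set.mem_ofPred_eq]
    refine eventually_all.2 fun j => ?_
    rcases (hx j).eq_or_lt with hj | hj
    · filter_upwards [self_mem_nhdsWithin] with t ht
      rw [inner_add_right, inner_smul_right, hj]
      have := mul_nonpos_of_nonneg_of_nonpos (le_of_lt ht) (hw j hj)
      linarith
    · have hlim : Tendsto (fun t : ℝ => ⟪b j, x + t • w⟫_ℝ) (𝓝 0)
          (𝓝 ⟪b j, x + (0 : ℝ) • w⟫_ℝ) := by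
        apply Continuous.tendsto; fun_prop
      rw [zero_smul, add_zero] at hlim
      exact ((hlim.mono_left nhdsWithin_le_nhds).eventually_lt_const hj).mono fun _ h => h.le

/-- The second subderivative of a piecewise linear-quadratic function at a subgradient bounds the
second-order difference quotients from above along rays. -/
theorem IsPLQ.eventually_secondDiffQuot_le [FiniteDimensional ℝ E] {g : E → EReal}
    (hg : IsPLQ g) {x v : E} {r : ℝ} (hx : g x = r)
    (hsub : ∀ (z : E) (s : ℝ), g z ≤ s → r + ⟪v, z - x⟫_ℝ ≤ s) {w : E} {c : ℝ}
    (hc : secondSubderiv g x v w < c) :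
    ∀ᶠ t in 𝓝[>] (0 : ℝ), secondDiffQuot g x v t w ≤ c := by
  have hbot := hg.ne_bot
  obtain ⟨m, C, A, a, α, hC, hA, hdom, hq⟩ := hg
  have hfreq := frequently_lt_of_liminf_lt (by isBoundedDefault) hc
  have hfreq' : ∃ᶠ p : ℝ × E in dirFilter w, ∃ i, x + p.1 • p.2 ∈ C i ∧ 0 < p.1 ∧
      secondDiffQuot g x v p.1 p.2 < c := by
    refine (hfreq.and_eventually (eventually_pos_dirFilter w)).mono fun p ⟨hp, hp0⟩ => ?_
    have hmem : x + p.1 • p.2 ∈ effDom g := lt_top_of_secondDiffQuot_lt hx hp0 hp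
    rw [hdom] at hmem
    obtain ⟨i, hi⟩ := Set.mem_iUnion.1 hmem
    exact ⟨i, hi, hp0, hp⟩
  -- There are finitely many pieces, so one of them contains `x + t w'` frequently with quotient
  -- below `c`.
  obtain ⟨i, hi⟩ := frequently_exists.1 hfreq'
  have hAc : Continuous (A i) := (A i).continuous_of_finiteDimensional
  have hxC : x ∈ C i := by
    refine (hC i).isClosed.mem_of_frequently_of_tendsto (hi.mono fun p hp => hp.1) ?_
    have : Tendsto (fun p : ℝ × E => x + p.1 • p.2) (𝓝 (0, w)) (𝓝 (x + (0 : ℝ) • w)) := by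
      apply Continuous.tendsto (f := fun p : ℝ × E => x + p.1 • p.2); fun_prop
    rw [zero_smul, add_zero] at this
    exact this.mono_left (dirFilter_le_nhds w)
  obtain ⟨T, hTc, hT1, hT2⟩ := (hC i).exists_tangentCone hxC
  -- Gradient of the `i`-th quadratic at `x`, minus `v`: the coefficient of the singular term `2 /
  -- t` in the quotient on `C i`.
  set l := A i x + a i - v with hl
  have hquot : ∀ (t : ℝ) (z : E), 0 < t → x + t • z ∈ C i →
      secondDiffQuot g x v t z = ((2 / t * ⟪l, z⟫_ℝ + ⟪A i z, z⟫_ℝ : ℝ) : EReal) := by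
    intro t z ht hz
    rw [secondDiffQuot_coe hx (hq i _ hz)]
    have hr : r = 1 / 2 * ⟪A i x, x⟫_ℝ + ⟪a i, x⟫_ℝ + α i := by
      have := hq i x hxC
      rw [hx] at this
      exact_mod_cast this
    have hsym : ⟪A i z, x⟫_ℝ = ⟪A i x, z⟫_ℝ := by
      rw [hA i z x, real_inner_comm]
    congr 1
    rw [hr, hl]
    simp only [map_add, map_smul, inner_add_left, inner_add_right, inner_sub_left,
      real_inner_smul_left, real_inner_smul_right, hsym]
    field_simp
    ring
  have hl0 : ∀ z ∈ T, 0 ≤ ⟪l, z⟫_ℝ := by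
    intro z hz
    have hlim : Tendsto (fun t : ℝ => ⟪l, z⟫_ℝ + t / 2 * ⟪A i z, z⟫_ℝ) (𝓝[>] 0) (𝓝 ⟪l, z⟫_ℝ) := by
      have : Tendsto (fun t : ℝ => ⟪l, z⟫_ℝ + t / 2 * ⟪A i z, z⟫_ℝ) (𝓝 0)
          (𝓝 (⟪l, z⟫_ℝ + 0 / 2 * ⟪A i z, z⟫_ℝ)) := by
        apply Continuous.tendsto; fun_prop
      simpa using this.mono_left nhdsWithin_le_nhds
    refine ge_of_tendsto hlim ?_
    filter_upwards [hT2 z hz, self_mem_nhdsWithin] with t htC ht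
    have ht' : 0 < t := ht
    have h1 := secondDiffQuot_nonneg hbot hx hsub ht' z
    rw [hquot t z ht htC, ← EReal.coe_zero, EReal.coe_le_coe_iff] at h1
    have h2 := mul_nonneg ht'.le h1
    have e : t * (2 / t * ⟪l, z⟫_ℝ + ⟪A i z, z⟫_ℝ) = 2 * (⟪l, z⟫_ℝ + t / 2 * ⟪A i z, z⟫_ℝ) := by
      field_simp
    linarith
  -- Multiplying the bound on the quotient by `t` makes it a closed condition. At `t = 0` it reads
  -- `⟪l, w⟫ ≤ 0`, hence `⟪l, w⟫ = 0`, and the quotient along the ray `w` is the constant `⟪A i w,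
  -- w⟫ ≤ c`.
  have hclosed : IsClosed {p : ℝ × E | p.2 ∈ T ∧ ⟪A i p.2, p.2⟫_ℝ ≤ c ∧
      2 * ⟪l, p.2⟫_ℝ ≤ p.1 * (c - ⟪A i p.2, p.2⟫_ℝ)} := by
    have h1 : Continuous fun p : ℝ × E => ⟪A i p.2, p.2⟫_ℝ :=
      (hAc.comp continuous_snd).inner continuous_snd
    exact (hTc.preimage continuous_snd).inter ((isClosed_le h1 continuous_const).inter
      (isClosed_le (by fun_prop : Continuous fun p : ℝ × E => 2 * ⟪l, p.2⟫_ℝ)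
        (by fun_prop : Continuous fun p : ℝ × E => p.1 * (c - ⟪A i p.2, p.2⟫_ℝ))))
  obtain ⟨hwT, hwc, hwl⟩ := hclosed.mem_of_frequently_of_tendsto
    (hi.mono fun p ⟨hp, hp0, hpc⟩ => by
      have hpT := hT1 _ hp0 _ hp
      rw [hquot _ _ hp0 hp, EReal.coe_lt_coe_iff] at hpc
      have h1 := hl0 _ hpT
      refine ⟨hpT, ?_, ?_⟩ <;> simp only [id]
      · have : 0 ≤ 2 / p.1 * ⟪l, p.2⟫_ℝ := by positivity
        linarith
      · have h2 : 2 / p.1 * ⟪l, p.2⟫_ℝ ≤ c - ⟪A i p.2, p.2⟫_ℝ := by linarith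
        have h3 := mul_le_mul_of_nonneg_left h2 hp0.le
        have e : p.1 * (2 / p.1 * ⟪l, p.2⟫_ℝ) = 2 * ⟪l, p.2⟫_ℝ := by field_simp
        linarith)
    (tendsto_id.mono_left (dirFilter_le_nhds w) : Tendsto id (dirFilter w) (𝓝 (0, w)))
  simp only [zero_mul] at hwl
  have hlw : ⟪l, w⟫_ℝ = 0 := le_antisymm (by linarith) (hl0 w hwT)
  filter_upwards [hT2 w hwT, self_mem_nhdsWithin] with t htC ht
  rw [hquot t w ht htC, hlw, mul_zero, zero_add]
  exact_mod_cast hwc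

end Polyhedral

/-! ### From continuous convergence to convergence of epigraphs. -/

section EpiConvergence

/-- A tube lemma: it turns local estimates in `(t, y)` into estimates uniform over a compact set. -/
theorem _root_.IsCompact.eventually_forall_of_eventually_prod {X Y : Type*} [TopologicalSpace Y]
    {l : Filter X} {K : Set Y} (hK : IsCompact K) {P : X → Y → Prop}
    (h : ∀ y ∈ K, ∀ᶠ p : X × Y in l ×ˢ 𝓝 y, P p.1 p.2) : ∀ᶠ x in l, ∀ y ∈ K, P x y := by
  have h1 : {p : X × Y | P p.1 p.2} ∈ l ×ˢ 𝓝ˢ K := hK.mem_prod_nhdsSet_of_forall h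
  have h2 : ∀ᶠ p : X × Y in l ×ˢ 𝓟 K, P p.1 p.2 :=
    Filter.prod_mono le_rfl principal_le_nhdsSet h1
  exact eventually_prod_principal_iff.1 h2

variable {E : Type*} [NormedAddCommGroup E] [InnerProductSpace ℝ E]

theorem lowerSemicontinuous_of_tendsto_dirFilter {q : ℝ → E → EReal} {D : E → EReal}
    (h : ∀ w, Tendsto (fun p : ℝ × E => q p.1 p.2) (dirFilter w) (𝓝 (D w))) :
    LowerSemicontinuous D := by
  intro w c hc
  obtain ⟨b, hcb, hb⟩ := exists_between hc
  have h1 := (h w).eventually_const_lt hb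
  obtain ⟨S, hS, U, hU, hSU⟩ := mem_prod_iff.1 h1
  filter_upwards [eventually_mem_nhds_iff.2 hU] with w' hw'
  exact hcb.trans_le (ge_of_tendsto (h w')
    (Filter.mem_of_superset (prod_mem_prod hS hw') fun p hp => by
      have : b < q p.1 p.2 := hSU hp
      exact this.le))

theorem isClosed_epi {D : E → EReal} (hD : LowerSemicontinuous D) : IsClosed (epi D) :=
  hD.isClosed_epigraph.preimage
    (f := fun p : WithLp 2 (E × ℝ) => (p.fst, ((p.snd : ℝ) : EReal)))
    ((WithLp.prod_continuous_ofLp 2 E ℝ).fst.prodMk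
      (continuous_coe_real_ereal.comp (WithLp.prod_continuous_ofLp 2 E ℝ).snd))

/-- Continuous convergence of the functions `q t` as `t ↓ 0` implies the convergence of the
distances to their epigraphs. -/
theorem tendsto_infEDist_epi [FiniteDimensional ℝ E] {q : ℝ → E → EReal} {D : E → EReal}
    (h : ∀ w, Tendsto (fun p : ℝ × E => q p.1 p.2) (dirFilter w) (𝓝 (D w)))
    (x : WithLp 2 (E × ℝ)) :
    Tendsto (fun t : ℝ => Metric.infEDist x (epi (q t))) (𝓝[>] (0 : ℝ))
      (𝓝 (Metric.infEDist x (epi D))) := by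
  refine tendsto_order.2 ⟨fun a ha => ?_, fun a ha => ?_⟩
  · obtain ⟨b, hab, hb⟩ := exists_between ha
    -- The closed ball of radius `b` is compact and misses `epi D`; continuous convergence keeps it
    -- off `epi (q t)`.
    have hbtop : b ≠ ⊤ := (hb.trans_le le_top).ne
    have hproper : ProperSpace (WithLp 2 (E × ℝ)) := FiniteDimensional.proper ℝ _
    have hK : IsCompact (Metric.closedBall x b.toReal) := isCompact_closedBall _ _
    have key : ∀ᶠ t in 𝓝[>] (0 : ℝ), ∀ k ∈ Metric.closedBall x b.toReal, k ∉ epi (q t) := by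
      refine hK.eventually_forall_of_eventually_prod fun k hk => ?_
      have hkD : k ∉ epi D := by
        intro hkD
        have h1 := Metric.infEDist_le_edist_of_mem (x := x) hkD
        have h2 : edist x k ≤ b := by
          rw [edist_comm, edist_dist]
          exact ENNReal.ofReal_le_of_le_toReal hk
        exact absurd (hb.trans_le (h1.trans h2)) (lt_irrefl b)
      have hlt : ((k.snd : ℝ) : EReal) < D k.fst := not_le.1 hkD
      obtain ⟨c, hc1, hc2⟩ := exists_between hlt
      have hfst : Tendsto (fun p : ℝ × WithLp 2 (E × ℝ) => (p.1, p.2.fst)) (𝓝[>] 0 ×ˢ 𝓝 k)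
          (dirFilter k.fst) :=
        tendsto_fst.prodMk
          (((WithLp.prod_continuous_ofLp 2 E ℝ).fst.tendsto k).comp tendsto_snd)
      have hsnd : Tendsto (fun p : ℝ × WithLp 2 (E × ℝ) => ((p.2.snd : ℝ) : EReal))
          (𝓝[>] 0 ×ˢ 𝓝 k) (𝓝 ((k.snd : ℝ) : EReal)) :=
        ((continuous_coe_real_ereal.comp (WithLp.prod_continuous_ofLp 2 E ℝ).snd).tendsto k).comp
          tendsto_snd
      filter_upwards [((h k.fst).comp hfst).eventually_const_lt hc2,
        hsnd.eventually_lt_const hc1] with p hp1 hp2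
      exact not_le.2 (hp2.trans hp1)
    filter_upwards [key] with t ht
    refine hab.trans_le (Metric.le_infEDist.2 fun k hk => ?_)
    by_contra hlt
    rw [not_le] at hlt
    refine ht k ?_ hk
    rw [Metric.mem_closedBall, dist_comm, dist_edist]
    exact ENNReal.toReal_mono hbtop hlt.le
  · obtain ⟨k, hk, hka⟩ := Metric.infEDist_lt_iff.1 ha
    -- Raising `k` slightly makes `D k.fst < k.snd + ε` strict, so the raised point lies in `epi (q
    -- t)` for small `t`.
    let γ : ℝ → WithLp 2 (E × ℝ) := fun ε => WithLp.toLp 2 (k.fst, k.snd + ε)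
    have hγ : Continuous γ := (WithLp.prod_continuous_toLp 2 E ℝ).comp (by fun_prop)
    have hγ0 : γ 0 = k := by
      simp only [γ, add_zero]
      rfl
    have hlim : Tendsto (fun ε => edist x (γ ε)) (𝓝 0) (𝓝 (edist x k)) := by
      have := (continuous_const (y := x)).edist hγ |>.tendsto 0
      rwa [hγ0] at this
    have hev : ∀ᶠ ε in 𝓝[>] (0 : ℝ), edist x (γ ε) < a :=
      (hlim.mono_left nhdsWithin_le_nhds).eventually_lt_const hka
    obtain ⟨ε, hεa, hε⟩ := (hev.and self_mem_nhdsWithin).exists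
    have hlt : D k.fst < ((k.snd + ε : ℝ) : EReal) :=
      lt_of_le_of_lt hk (by exact_mod_cast lt_add_of_pos_right k.snd hε)
    have hray : Tendsto (fun t : ℝ => (t, k.fst)) (𝓝[>] 0) (dirFilter k.fst) :=
      tendsto_id.prodMk tendsto_const_nhds
    filter_upwards [((h k.fst).comp hray).eventually_lt_const hlt] with t ht
    exact (Metric.infEDist_le_edist_of_mem (show γ ε ∈ epi (q t) from ht.le)).trans_lt hεa

end EpiConvergence

/-! ### Second-order quotients of the Moreau envelope. -/

section Envelope

variable {E : Type*} [NormedAddCommGroup E] [InnerProductSpace ℝ E]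
variable {ρ : ℝ} {g : E → EReal} {y zbar : E} {r : ℝ}

/-- The cross term of the expanded square converts the linear term in `u` into one in `z`. Dividing
by `t² / 2` turns the penalty `ρ / 2` into `ρ`, whence the parameter `1 / (2ρ)`. -/
theorem secondDiffQuot_add_prox_eq {t s : ℝ} (ht : 0 < t) (u z : E) :
    (s + ρ / 2 * ‖(y + t • u) - (zbar + t • z)‖ ^ 2 - (r + ρ / 2 * ‖y - zbar‖ ^ 2)
        - t * ⟪ρ • (y - zbar), u⟫_ℝ) / (1 / 2 * t ^ 2) =
      (s - r - t * ⟪ρ • (y - zbar), z⟫_ℝ) / (1 / 2 * t ^ 2) + ρ * ‖u - z‖ ^ 2 := by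
  have e : (y + t • u) - (zbar + t • z) = (y - zbar) + t • (u - z) := by module
  rw [e, norm_add_sq_real, norm_smul, Real.norm_of_nonneg ht.le, inner_smul_right,
    inner_sub_right]
  simp only [real_inner_smul_left]
  field_simp
  ring

theorem moreauEnv_apply_half (h : E → EReal) (u : E) (ρ : ℝ) :
    moreauEnv (1 / (2 * ρ)) h u = ⨅ z, h z + ((ρ * ‖u - z‖ ^ 2 : ℝ) : EReal) := by
  have e : 1 / (2 * (1 / (2 * ρ))) = ρ := by
    rcases eq_or_ne ρ 0 with rfl | h <;> [simp; field_simp]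
  rw [moreauEnv, e]

/-- Joint lower semicontinuity in `(t, u', z)`; the finite penalty is moved to the other side to
keep the `EReal` arithmetic safe. -/
theorem eventually_lt_secondDiffQuot_add {v u z : E} {c' : ℝ}
    (h1 : (c' : EReal) < secondSubderiv g zbar v z + ((ρ * ‖u - z‖ ^ 2 : ℝ) : EReal)) :
    ∀ᶠ p : (ℝ × E) × E in dirFilter u ×ˢ 𝓝 z,
      (c' : EReal) < secondDiffQuot g zbar v p.1.1 p.2
        + ((ρ * ‖p.1.2 - p.2‖ ^ 2 : ℝ) : EReal) := by
  have h2 : ((c' - ρ * ‖u - z‖ ^ 2 : ℝ) : EReal) < secondSubderiv g zbar v z := by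
    by_contra hcon
    rw [not_lt] at hcon
    have := h1.trans_le (add_le_add_left hcon _)
    rw [← EReal.coe_add, sub_add_cancel] at this
    exact lt_irrefl _ this
  obtain ⟨c₁, hc₁, hc₁'⟩ := EReal.exists_between_coe_real h2
  rw [EReal.coe_lt_coe_iff] at hc₁
  have h3 := eventually_lt_of_lt_liminf hc₁'
  have hmap : Tendsto (fun p : (ℝ × E) × E => (p.1.1, p.2)) (dirFilter u ×ˢ 𝓝 z)
      (dirFilter z) :=
    ((tendsto_fst_dirFilter u).comp tendsto_fst).prodMk tendsto_snd
  have hcont : Tendsto (fun p : (ℝ × E) × E => c' - ρ * ‖p.1.2 - p.2‖ ^ 2)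
      (dirFilter u ×ˢ 𝓝 z) (𝓝 (c' - ρ * ‖u - z‖ ^ 2)) := by
    have h4 : Tendsto (fun p : (ℝ × E) × E => p.1.2) (dirFilter u ×ˢ 𝓝 z) (𝓝 u) :=
      tendsto_snd.comp tendsto_fst
    have h5 : Tendsto (fun p : (ℝ × E) × E => p.2) (dirFilter u ×ˢ 𝓝 z) (𝓝 z) := tendsto_snd
    exact (((h4.sub h5).norm.pow 2).const_mul ρ).const_sub c'
  have h6 := hmap.eventually h3
  have h7 := hcont.eventually_lt_const hc₁
  refine (h6.and h7).mono fun p hp => ?_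
  have h8 : ((c₁ + ρ * ‖p.1.2 - p.2‖ ^ 2 : ℝ) : EReal) < secondDiffQuot g zbar v p.1.1 p.2
      + ((ρ * ‖p.1.2 - p.2‖ ^ 2 : ℝ) : EReal) := by
    rw [EReal.coe_add]
    exact EReal.add_lt_add_right_coe hp.1 _
  refine lt_of_le_of_lt (EReal.coe_le_coe_iff.2 ?_) h8
  linarith [hp.2]

namespace IsProxPoint

/-- The point `zbar + t z` competes in the infimum at `y + t u`. -/
theorem secondDiffQuot_moreauEnv_le (h : IsProxPoint ρ g y zbar r) (hbot : ∀ z, g z ≠ ⊥)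
    (hex : ∀ y, ∃ zbar r, IsProxPoint ρ g y zbar r) {t c : ℝ} (ht : 0 < t) {z : E} (u : E)
    (hz : secondDiffQuot g zbar (ρ • (y - zbar)) t z ≤ c) :
    secondDiffQuot (moreauEnv (1 / ρ) g) y (ρ • (y - zbar)) t u ≤
      ((c + ρ * ‖u - z‖ ^ 2 : ℝ) : EReal) := by
  obtain ⟨z', r', h'⟩ := hex (y + t • u)
  have htop := lt_top_of_secondDiffQuot_lt h.eq ht (hz.trans_lt (EReal.coe_lt_top c))
  obtain ⟨s, hs⟩ := exists_real_of_ne_bot (hbot _) htop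
  rw [secondDiffQuot_coe h.eq hs, EReal.coe_le_coe_iff] at hz
  rw [secondDiffQuot_coe (h.moreauEnv_eq hbot) (h'.moreauEnv_eq hbot), EReal.coe_le_coe_iff]
  refine le_trans ?_ (add_le_add_left hz _)
  rw [← secondDiffQuot_add_prox_eq ht]
  gcongr ?_ / _
  have := h'.le _ s hs.le
  linarith

theorem exists_secondDiffQuot_moreauEnv_eq (h : IsProxPoint ρ g y zbar r)
    (hbot : ∀ z, g z ≠ ⊥) (hex : ∀ y, ∃ zbar r, IsProxPoint ρ g y zbar r) {t : ℝ} (ht : 0 < t)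
    (u : E) :
    ∃ z, secondDiffQuot (moreauEnv (1 / ρ) g) y (ρ • (y - zbar)) t u =
      secondDiffQuot g zbar (ρ • (y - zbar)) t z + ((ρ * ‖u - z‖ ^ 2 : ℝ) : EReal) := by
  obtain ⟨z', r', h'⟩ := hex (y + t • u)
  have e : zbar + t • (t⁻¹ • (z' - zbar)) = z' := by
    rw [smul_inv_smul₀ ht.ne', add_sub_cancel]
  -- The difference quotient of proximal points attains the infimum.
  refine ⟨t⁻¹ • (z' - zbar), ?_⟩
  rw [secondDiffQuot_coe (h.moreauEnv_eq hbot) (h'.moreauEnv_eq hbot),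
    secondDiffQuot_coe h.eq (by rw [e]; exact h'.eq), ← EReal.coe_add,
    ← secondDiffQuot_add_prox_eq ht, e]

/-- If the second subderivative of `g` is recovered along rays, then the second-order difference
quotients of the Moreau envelope converge continuously to an envelope of it. -/
theorem tendsto_secondDiffQuot_moreauEnv [FiniteDimensional ℝ E] (h : IsProxPoint ρ g y zbar r)
    (hρ : 0 < ρ) (hc : Convex ℝ (epi g)) (hbot : ∀ z, g z ≠ ⊥)
    (hex : ∀ y, ∃ zbar r, IsProxPoint ρ g y zbar r)
    (hrec : ∀ (w : E) (c : ℝ), secondSubderiv g zbar (ρ • (y - zbar)) w < c →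
      ∀ᶠ t in 𝓝[>] (0 : ℝ), secondDiffQuot g zbar (ρ • (y - zbar)) t w ≤ c) (u : E) :
    Tendsto (fun p : ℝ × E => secondDiffQuot (moreauEnv (1 / ρ) g) y (ρ • (y - zbar)) p.1 p.2)
      (dirFilter u)
      (𝓝 (moreauEnv (1 / (2 * ρ)) (secondSubderiv g zbar (ρ • (y - zbar))) u)) := by
  have hsub : ∀ (z : E) (s : ℝ), g z ≤ s → r + ⟪ρ • (y - zbar), z - zbar⟫_ℝ ≤ s :=
    fun z s hs => h.subgradient hc hs
  have hnn := secondSubderiv_nonneg hbot h.eq hsub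
  set v := ρ • (y - zbar) with hv
  rw [moreauEnv_apply_half]
  refine tendsto_order.2 ⟨fun c hcD => ?_, fun c hcD => ?_⟩
  · obtain ⟨c', hcc', hc'⟩ := EReal.exists_between_coe_real hcD
    -- For `u'` within 1 of `u` and `z` outside this ball, `‖u' - z‖ ≥ 1 + |c'| / ρ`, so the penalty
    -- alone is at least `|c'|`.
    set R : ℝ := 2 + |c'| / ρ with hR
    have hball : ∀ᶠ p : ℝ × E in dirFilter u, ∀ z ∈ Metric.closedBall u R,
        (c' : EReal) < secondDiffQuot g zbar v p.1 z + ((ρ * ‖p.2 - z‖ ^ 2 : ℝ) : EReal) :=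
      (isCompact_closedBall u R).eventually_forall_of_eventually_prod fun z _ =>
        eventually_lt_secondDiffQuot_add (hc'.trans_le (iInf_le _ z))
    have hnear : ∀ᶠ p : ℝ × E in dirFilter u, p.2 ∈ Metric.ball u 1 :=
      tendsto_snd.eventually (Metric.ball_mem_nhds u zero_lt_one)
    filter_upwards [hball, hnear, eventually_pos_dirFilter u] with p hp hp1 hp0
    obtain ⟨z, hz⟩ := h.exists_secondDiffQuot_moreauEnv_eq hbot hex hp0 p.2
    rw [hz]
    refine hcc'.trans_le ?_
    by_cases hzR : z ∈ Metric.closedBall u R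
    · exact (hp z hzR).le
    · have h1 : (0 : EReal) + ((ρ * ‖p.2 - z‖ ^ 2 : ℝ) : EReal) ≤
          secondDiffQuot g zbar v p.1 z + ((ρ * ‖p.2 - z‖ ^ 2 : ℝ) : EReal) :=
        add_le_add_left (secondDiffQuot_nonneg hbot h.eq hsub hp0 z) _
      refine le_trans ?_ h1
      rw [zero_add, EReal.coe_le_coe_iff]
      rw [Metric.mem_closedBall, not_le, dist_comm] at hzR
      rw [Metric.mem_ball] at hp1
      have h2 : 1 + |c'| / ρ ≤ ‖p.2 - z‖ := by
        have := dist_triangle u p.2 z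
        rw [dist_comm u p.2] at this
        rw [← dist_eq_norm]
        linarith
      have h3 : 0 ≤ |c'| / ρ := by positivity
      have h4 : |c'| / ρ ≤ ‖p.2 - z‖ ^ 2 := by nlinarith
      calc c' ≤ |c'| := le_abs_self c'
        _ = ρ * (|c'| / ρ) := by field_simp
        _ ≤ ρ * ‖p.2 - z‖ ^ 2 := by gcongr
  · obtain ⟨z, hz⟩ := iInf_lt_iff.1 hcD
    obtain ⟨c₀, hc₀, hc₀c⟩ := EReal.exists_between_coe_real hz
    have hzbot : secondSubderiv g zbar v z ≠ ⊥ :=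
      fun hb => absurd (hnn z) (by rw [hb]; exact not_le.2 EReal.bot_lt_zero)
    have hztop : secondSubderiv g zbar v z < ⊤ := by
      by_contra htop
      rw [not_lt, top_le_iff] at htop
      rw [htop, EReal.top_add_coe] at hc₀
      exact not_top_lt hc₀
    obtain ⟨d, hd⟩ := exists_real_of_ne_bot hzbot hztop
    rw [hd, ← EReal.coe_add, EReal.coe_lt_coe_iff] at hc₀
    obtain ⟨c₁, hdc₁, hc₁⟩ := exists_between (show d < c₀ - ρ * ‖u - z‖ ^ 2 by linarith)
    -- One fixed `z` serves all nearby `u'`, since only the penalty depends on `u'`.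
    have hev := hrec z c₁ (by rw [hd]; exact_mod_cast hdc₁)
    have hcont : Tendsto (fun p : ℝ × E => c₁ + ρ * ‖p.2 - z‖ ^ 2) (dirFilter u)
        (𝓝 (c₁ + ρ * ‖u - z‖ ^ 2)) := by
      have h5 : Continuous fun p : E => c₁ + ρ * ‖p - z‖ ^ 2 := by fun_prop
      exact (h5.tendsto u).comp tendsto_snd
    filter_upwards [(tendsto_fst_dirFilter u).eventually hev, eventually_pos_dirFilter u,
      hcont.eventually_lt_const (show _ < c₀ by linarith)] with p hp1 hp0 hp2
    refine (h.secondDiffQuot_moreauEnv_le hbot hex hp0 p.2 hp1).trans_lt (lt_trans ?_ hc₀c)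
    exact_mod_cast hp2

end IsProxPoint

end Envelope

/-! ### Second-order expansion of smooth functions. -/

section Smooth

theorem secondDiffQuot_real {E : Type*} [NormedAddCommGroup E] [InnerProductSpace ℝ E]
    (f : E → ℝ) (x v w : E) (t : ℝ) :
    secondDiffQuot (fun x => (f x : EReal)) x v t w =
      (((f (x + t • w) - f x - t * ⟪v, w⟫_ℝ) / (1 / 2 * t ^ 2) : ℝ) : EReal) :=
  secondDiffQuot_coe rfl rfl

variable {E F : Type*} [NormedAddCommGroup E] [InnerProductSpace ℝ E]
  [NormedAddCommGroup F] [InnerProductSpace ℝ F]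

theorem tendsto_smul_dirFilter (w : E) :
    Tendsto (fun p : ℝ × E => p.1 • p.2) (dirFilter w) (𝓝 0) := by
  have : Tendsto (fun p : ℝ × E => p.1 • p.2) (𝓝 (0, w)) (𝓝 ((0 : ℝ) • w)) := by
    apply Continuous.tendsto (f := fun p : ℝ × E => p.1 • p.2); fun_prop
  rw [zero_smul] at this
  exact this.mono_left (dirFilter_le_nhds w)

theorem _root_.HasFDerivAt.tendsto_dirFilter {f : E → F} {f' : E →L[ℝ] F} {x : E}
    (hf : HasFDerivAt f f' x) (w : E) :
    Tendsto (fun p : ℝ × E => p.1⁻¹ • (f (x + p.1 • p.2) - f x)) (dirFilter w) (𝓝 (f' w)) := by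
  refine (hasFDerivWithinAt_univ.2 hf).lim (tendsto_smul_dirFilter w)
    (Eventually.of_forall fun _ => Set.mem_univ _) ?_
  refine (tendsto_snd : Tendsto Prod.snd (dirFilter w) (𝓝 w)).congr' ?_
  filter_upwards [eventually_pos_dirFilter w] with p hp
  rw [inv_smul_smul₀ hp.ne']

theorem isLittleO_taylor_two [CompleteSpace E] {f : E → ℝ} (hf : Differentiable ℝ f) {x : E}
    {H : E →L[ℝ] E} (hH : HasFDerivAt (gradient f) H x) :
    (fun h => f (x + h) - f x - ⟪gradient f x, h⟫_ℝ - 1 / 2 * ⟪H h, h⟫_ℝ) =o[𝓝 0]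
      fun h : E => ‖h‖ ^ 2 := by
  rw [Asymptotics.isLittleO_iff]
  intro ε hε
  have h1 := (hasFDerivAt_iff_isLittleO_nhds_zero.1 hH)
  obtain ⟨δ, hδ, hb⟩ := Metric.eventually_nhds_iff_ball.1 (Asymptotics.isLittleO_iff.1 h1 hε)
  filter_upwards [Metric.ball_mem_nhds (0 : E) hδ] with h hh
  -- The Taylor remainder along the segment. Its derivative is the first-order error of `gradient f`
  -- paired with `h`, at most `ε ‖h‖²`.
  let ψ : ℝ → ℝ := fun s => f (x + s • h) - s * ⟪gradient f x, h⟫_ℝ - s ^ 2 / 2 * ⟪H h, h⟫_ℝ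
  have hψ : ∀ s : ℝ, HasDerivAt ψ
      (⟪gradient f (x + s • h) - gradient f x - H (s • h), h⟫_ℝ) s := by
    intro s
    have d1 : HasDerivAt (fun s : ℝ => x + s • h) h s := by
      simpa using ((hasDerivAt_id s).smul_const h).const_add x
    have d2 := ((hf (x + s • h)).hasFDerivAt).comp_hasDerivAt s d1
    have d3 : HasDerivAt (fun s : ℝ => s * ⟪gradient f x, h⟫_ℝ) ⟪gradient f x, h⟫_ℝ s := by
      simpa using (hasDerivAt_id s).mul_const ⟪gradient f x, h⟫_ℝ
    have d4 : HasDerivAt (fun s : ℝ => s ^ 2 / 2 * ⟪H h, h⟫_ℝ) (s * ⟪H h, h⟫_ℝ) s := by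
      have := (((hasDerivAt_id s).pow 2).div_const 2).mul_const ⟪H h, h⟫_ℝ
      simpa using this
    refine ((d2.sub d3).sub d4).congr_deriv ?_
    rw [inner_sub_left, inner_sub_left, inner_gradient_left, inner_gradient_left, map_smul, real_inner_smul_left]
  have hmv := norm_image_sub_le_of_norm_deriv_le_segment_01' (f := ψ) (C := ε * ‖h‖ ^ 2)
    (fun s _ => (hψ s).hasDerivWithinAt) (fun s hs => by
      have hs1 : ‖s • h‖ ≤ ‖h‖ := by
        rw [norm_smul, Real.norm_of_nonneg hs.1]
        exact mul_le_of_le_one_left (norm_nonneg h) hs.2.le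
      have hmem : s • h ∈ Metric.ball (0 : E) δ := by
        rw [mem_ball_zero_iff] at hh ⊢
        exact hs1.trans_lt hh
      calc ‖⟪gradient f (x + s • h) - gradient f x - H (s • h), h⟫_ℝ‖
          ≤ ‖gradient f (x + s • h) - gradient f x - H (s • h)‖ * ‖h‖ := norm_inner_le_norm _ _
        _ ≤ ε * ‖s • h‖ * ‖h‖ := by gcongr; exact hb _ hmem
        _ ≤ ε * ‖h‖ * ‖h‖ := by gcongr
        _ = ε * ‖h‖ ^ 2 := by ring)
  rw [Real.norm_of_nonneg (by positivity : 0 ≤ ‖h‖ ^ 2)]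
  refine le_trans (le_of_eq ?_) hmv
  simp only [ψ, one_smul, zero_smul, add_zero]
  congr 1
  ring

theorem _root_.ContDiff.differentiable_gradient [CompleteSpace E] {f : E → ℝ}
    (hf : ContDiff ℝ 2 f) : Differentiable ℝ (gradient f) := by
  have h1 : Differentiable ℝ (fderiv ℝ f) :=
    (hf.fderiv_right (m := 1) (by norm_num)).differentiable (by norm_num)
  have h2 : gradient f = fun x => (toDual ℝ E).symm.toContinuousLinearEquiv (fderiv ℝ f x) := rfl
  rw [h2]
  exact (toDual ℝ E).symm.toContinuousLinearEquiv.differentiable.comp h1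

/-- The second-order difference quotients of a `C²` function converge continuously to the
quadratic form of the Hessian. -/
theorem _root_.ContDiff.tendsto_secondDiffQuot [CompleteSpace E] {f : E → ℝ}
    (hf : ContDiff ℝ 2 f) (x w : E) :
    Tendsto (fun p : ℝ × E => (f (x + p.1 • p.2) - f x - p.1 * ⟪gradient f x, p.2⟫_ℝ) /
      (1 / 2 * p.1 ^ 2)) (dirFilter w) (𝓝 ⟪hessian f x w, w⟫_ℝ) := by
  have hH : HasFDerivAt (gradient f) (hessian f x) x :=
    (hf.differentiable_gradient x).hasFDerivAt
  set H := hessian f x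
  have h1 := (isLittleO_taylor_two (hf.differentiable (by norm_num)) hH).comp_tendsto
    (tendsto_smul_dirFilter w)
  have hbd : (fun p : ℝ × E => ‖p.2‖ ^ 2) =O[dirFilter w] fun _ => (1 : ℝ) := by
    have : Tendsto (fun p : ℝ × E => ‖p.2‖ ^ 2) (dirFilter w) (𝓝 (‖w‖ ^ 2)) :=
      ((by fun_prop : Continuous fun z : E => ‖z‖ ^ 2).tendsto w).comp tendsto_snd
    exact this.isBigO_one ℝ
  have h2 : (fun p : ℝ × E => ‖p.1 • p.2‖ ^ 2) =O[dirFilter w] fun p => p.1 ^ 2 := by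
    have := (Asymptotics.isBigO_refl (fun p : ℝ × E => p.1 ^ 2) (dirFilter w)).mul hbd
    simpa [norm_smul, mul_pow] using this
  have h3 := (h1.trans_isBigO h2).tendsto_div_nhds_zero
  have h4 : Tendsto (fun p : ℝ × E => ⟪H p.2, p.2⟫_ℝ) (dirFilter w) (𝓝 ⟪H w, w⟫_ℝ) :=
    ((by fun_prop : Continuous fun z : E => ⟪H z, z⟫_ℝ).tendsto w).comp tendsto_snd
  have h5 := h4.add (h3.const_mul 2)
  rw [mul_zero, add_zero] at h5
  refine h5.congr' ?_
  filter_upwards [eventually_pos_dirFilter w] with p hp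
  simp only [Function.comp_apply, map_smul, real_inner_smul_left, real_inner_smul_right]
  field_simp
  ring

end Smooth

/-! ### Consequences of continuous convergence of the quotients. -/

section SecondOrder

variable {E : Type*} [NormedAddCommGroup E] [InnerProductSpace ℝ E]

/-- A function that is differentiable at a point and whose second-order difference quotients
converge continuously is twice semidifferentiable there. -/
theorem isTwiceSemidifferentiableAt_of_tendsto [CompleteSpace E] {f : E → ℝ} {x v : E}
    {D : E → EReal} (hf : HasGradientAt f v x)
    (h : ∀ w, Tendsto (fun p : ℝ × E => secondDiffQuot (fun x => (f x : EReal)) x v p.1 p.2)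
      (dirFilter w) (𝓝 (D w))) :
    IsTwiceSemidifferentiableAt (fun x => (f x : EReal)) x := by
  have hlim : ∀ w, Tendsto (fun p : ℝ × E => diffQuot (fun x => (f x : EReal)) x p.1 p.2)
      (dirFilter w) (𝓝 ((⟪v, w⟫_ℝ : ℝ) : EReal)) := by
    intro w
    have h1 := (hf.hasFDerivAt.tendsto_dirFilter w)
    refine ((continuous_coe_real_ereal.tendsto _).comp h1).congr fun p => ?_
    rw [Function.comp_apply, smul_eq_mul, ← div_eq_inv_mul, EReal.coe_div, EReal.coe_sub,
      diffQuot]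
  have hsub : ∀ w, subderiv (fun x => (f x : EReal)) x w = ((⟪v, w⟫_ℝ : ℝ) : EReal) :=
    fun w => (hlim w).liminf_eq
  refine ⟨⟨EReal.coe_ne_bot _, EReal.coe_ne_top _, fun w => by rw [hsub w]; exact hlim w⟩,
    fun w => ?_⟩
  have hfree : (fun p : ℝ × E => secondDiffQuotFree (fun x => (f x : EReal)) x p.1 p.2) =
      fun p : ℝ × E => secondDiffQuot (fun x => (f x : EReal)) x v p.1 p.2 := by
    funext p
    rw [secondDiffQuotFree, secondDiffQuot, hsub, EReal.coe_mul p.1]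
  rw [secondSubderivFree, hfree, (h w).liminf_eq]
  exact h w

theorem isTwiceEpiDifferentiableAt_of_tendsto [FiniteDimensional ℝ E] {f : E → EReal} {x v : E}
    {D : E → EReal} (hbot : f x ≠ ⊥) (htop : f x ≠ ⊤)
    (h : ∀ w, Tendsto (fun p : ℝ × E => secondDiffQuot f x v p.1 p.2) (dirFilter w)
      (𝓝 (D w))) :
    IsTwiceEpiDifferentiableAt f x v := by
  have hD : secondSubderiv f x v = D := funext fun w => (h w).liminf_eq
  refine ⟨hbot, htop, ?_, fun p => ?_⟩
  · rw [hD]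
    exact isClosed_epi (lowerSemicontinuous_of_tendsto_dirFilter h)
  · rw [hD]
    exact tendsto_infEDist_epi h p

end SecondOrder

/-! ### Chain rule for the composite term. -/

section Composite

variable {E F : Type*} [NormedAddCommGroup E] [InnerProductSpace ℝ E]
  [NormedAddCommGroup F] [InnerProductSpace ℝ F]

theorem hasFDerivAt_lagrangian {φ : E → ℝ} {Φ : E → F} {x : E} (hφ : DifferentiableAt ℝ φ x)
    (hΦ : DifferentiableAt ℝ Φ x) (μ : F) :
    HasFDerivAt (fun x => lagrangian φ Φ x μ)
      (fderiv ℝ φ x + (innerSL ℝ μ).comp (fderiv ℝ Φ x)) x := by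
  refine hφ.hasFDerivAt.add ?_
  refine ((innerSL ℝ μ).hasFDerivAt.comp x hΦ.hasFDerivAt).congr_of_eventuallyEq
    (Eventually.of_forall fun z => ?_)
  simp [real_inner_comm]

/-- Both sides have derivative `∇φ + ∇Φ* μ`; this identifies the gradient of the augmented
Lagrangian with that of `L(·, μ)`. -/
theorem hasGradientAt_add_comp [CompleteSpace E] [CompleteSpace F] {φ : E → ℝ} {Φ : E → F}
    {e : F → ℝ} {x : E} {b μ : F} (c : ℝ) (hφ : DifferentiableAt ℝ φ x)
    (hΦ : DifferentiableAt ℝ Φ x) (he : HasGradientAt e μ (Φ x + b)) :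
    HasGradientAt (fun z => φ z + e (Φ z + b) - c)
      (gradient (fun x => lagrangian φ Φ x μ) x) x := by
  have h1 : HasFDerivAt (fun z => φ z + e (Φ z + b) - c)
      (fderiv ℝ φ x + (innerSL ℝ μ).comp (fderiv ℝ Φ x)) x :=
    (hφ.hasFDerivAt.add
      (he.hasFDerivAt.comp x (hΦ.hasFDerivAt.add_const b))).sub_const c
  have h2 := hasFDerivAt_lagrangian hφ hΦ μ
  rw [hasGradientAt_iff_hasFDerivAt, toDual_gradient, h2.fderiv]
  exact h1

theorem contDiff_lagrangian {φ : E → ℝ} {Φ : E → F} (hφ : ContDiff ℝ 2 φ) (hΦ : ContDiff ℝ 2 Φ)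
    (μ : F) : ContDiff ℝ 2 (fun x => lagrangian φ Φ x μ) :=
  hφ.add (hΦ.inner ℝ contDiff_const)

/-- A second-order chain rule for compositions with continuously convergent second-order
difference quotients. -/
theorem tendsto_secondDiffQuot_add_comp [CompleteSpace E] {φ : E → ℝ} {Φ : E → F}
    (hφ : ContDiff ℝ 2 φ) (hΦ : ContDiff ℝ 2 Φ) {e : F → ℝ} {x : E} {b μ : F} (c : ℝ)
    {D : F → EReal}
    (he : ∀ u, Tendsto (fun p : ℝ × F =>
      secondDiffQuot (fun y => (e y : EReal)) (Φ x + b) μ p.1 p.2) (dirFilter u) (𝓝 (D u)))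
    (w : E) :
    Tendsto (fun p : ℝ × E => secondDiffQuot (fun z => ((φ z + e (Φ z + b) - c : ℝ) : EReal)) x
        (gradient (fun x => lagrangian φ Φ x μ) x) p.1 p.2) (dirFilter w)
      (𝓝 (((⟪hessian (fun x => lagrangian φ Φ x μ) x w, w⟫_ℝ : ℝ) : EReal)
        + D (fderiv ℝ Φ x w))) := by
  have hΦd := (hΦ.differentiable (by norm_num) x).hasFDerivAt
  have h1 : Tendsto (fun p : ℝ × E => (p.1, p.1⁻¹ • (Φ (x + p.1 • p.2) - Φ x))) (dirFilter w)
      (dirFilter (fderiv ℝ Φ x w)) :=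
    (tendsto_fst_dirFilter w).prodMk (hΦd.tendsto_dirFilter w)
  have h2 := (he _).comp h1
  have h3 := (continuous_coe_real_ereal.tendsto _).comp
    ((contDiff_lagrangian hφ hΦ μ).tendsto_secondDiffQuot x w)
  -- Addition is continuous here because the Hessian term is finite.
  have h4 := (EReal.continuousAt_add (p := (((⟪hessian (fun x => lagrangian φ Φ x μ) x w, w⟫_ℝ :
    ℝ) : EReal), D (fderiv ℝ Φ x w))) (.inl (EReal.coe_ne_top _))
    (.inl (EReal.coe_ne_bot _))).tendsto.comp (h3.prodMk_nhds h2)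
  refine h4.congr' ?_
  filter_upwards [eventually_pos_dirFilter w] with p hp
  simp only [Function.comp_apply]
  rw [secondDiffQuot_real, secondDiffQuot_real, ← EReal.coe_add]
  congr 1
  have e1 : Φ x + b + p.1 • p.1⁻¹ • (Φ (x + p.1 • p.2) - Φ x) = Φ (x + p.1 • p.2) + b := by
    rw [smul_inv_smul₀ hp.ne']
    abel
  rw [e1, ← add_div]
  congr 1
  -- The envelope's linear term is `⟪μ, Φ(x + t w') - Φ(x)⟫`, which cancels the `μ`-part of the
  -- increment of `L(·, μ)`.
  simp only [lagrangian, real_inner_smul_right, inner_sub_right, real_inner_comm μ]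
  field_simp
  ring

end Composite

end VarAnalysis

/-! ### Assembly of the theorem. -/

theorem theorem3p4 (n m : ℕ)
    (φ : EuclideanSpace ℝ (Fin n) → ℝ) (hφ : ContDiff ℝ 2 φ)
    (Φ : EuclideanSpace ℝ (Fin n) → EuclideanSpace ℝ (Fin m)) (hΦ : ContDiff ℝ 2 Φ)
    (g : EuclideanSpace ℝ (Fin m) → EReal) (hg : IsCPLQ g) (hdom : (effDom g).Nonempty)
    (xbar : EuclideanSpace ℝ (Fin n)) (lam : EuclideanSpace ℝ (Fin m)) (ρ : ℝ) (hρ : 0 < ρ)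
    (μ : EuclideanSpace ℝ (Fin m))
    (hμ : μ = gradient (fun y => (moreauEnv (1 / ρ) g y).toReal) (Φ xbar + ρ⁻¹ • lam))
    (v : EuclideanSpace ℝ (Fin n))
    (hv : v = gradient (fun x => (augLagrangian φ Φ g x lam ρ).toReal) xbar) :
    -- the envelope and the augmented Lagrangian are finite, and the two gradients exist
    (∀ y, moreauEnv (1 / ρ) g y ≠ ⊥ ∧ moreauEnv (1 / ρ) g y ≠ ⊤) ∧
    (∀ x, augLagrangian φ Φ g x lam ρ ≠ ⊥ ∧ augLagrangian φ Φ g x lam ρ ≠ ⊤) ∧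
    DifferentiableAt ℝ (fun y => (moreauEnv (1 / ρ) g y).toReal) (Φ xbar + ρ⁻¹ • lam) ∧
    DifferentiableAt ℝ (fun x => (augLagrangian φ Φ g x lam ρ).toReal) xbar ∧
    IsTwiceSemidifferentiableAt (fun x => augLagrangian φ Φ g x lam ρ) xbar ∧
    IsTwiceEpiDifferentiableAt (fun x => augLagrangian φ Φ g x lam ρ) xbar v ∧
    ∀ w : EuclideanSpace ℝ (Fin n),
      secondSubderiv (fun x => augLagrangian φ Φ g x lam ρ) xbar v w =
        ((inner ℝ (hessian (fun x => lagrangian φ Φ x μ) xbar w) w : ℝ) : EReal) +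
          moreauEnv (1 / (2 * ρ))
            (fun z => secondSubderiv g (Φ xbar + ρ⁻¹ • (lam - μ)) μ z)
            (fderiv ℝ Φ xbar w) := by
  have hc := hg.2
  have hbot := hg.1.ne_bot
  have hex : ∀ y, ∃ zbar r, IsProxPoint ρ g y zbar r :=
    exists_isProxPoint hc hg.1.lowerSemicontinuous hbot hdom hρ
  have henv : ∀ y, moreauEnv (1 / ρ) g y ≠ ⊥ ∧ moreauEnv (1 / ρ) g y ≠ ⊤ := by
    intro y
    obtain ⟨z, r, h⟩ := hex y
    rw [h.moreauEnv_eq hbot]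
    exact ⟨EReal.coe_ne_bot _, EReal.coe_ne_top _⟩
  set y := Φ xbar + ρ⁻¹ • lam with hy
  obtain ⟨zbar, r, hz⟩ := hex y
  have hgrad := hz.hasGradientAt hρ hc hbot hex
  have hμ' : μ = ρ • (y - zbar) := hμ.trans hgrad.gradient
  rw [← hμ'] at hgrad
  -- Solving `μ = ρ (y - zbar)` for `zbar` shows that the base point of `d²g` is the proximal point.
  have hzbar : zbar = Φ xbar + ρ⁻¹ • (lam - μ) := by
    rw [hμ', smul_sub, inv_smul_smul₀ hρ.ne', hy]
    abel
  set e : EuclideanSpace ℝ (Fin m) → ℝ := fun y => (moreauEnv (1 / ρ) g y).toReal with he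
  have hecoe : moreauEnv (1 / ρ) g = fun y => (e y : EReal) :=
    funext fun y => (EReal.coe_toReal (henv y).2 (henv y).1).symm
  have hlim := hz.tendsto_secondDiffQuot_moreauEnv hρ hc hbot hex fun w c hw =>
    hg.1.eventually_secondDiffQuot_le hz.eq (fun z s hs => hz.subgradient hc hs) hw
  rw [← hμ', hzbar, hecoe] at hlim
  have haug : (fun x => augLagrangian φ Φ g x lam ρ) = fun x =>
      ((φ x + e (Φ x + ρ⁻¹ • lam) - 1 / 2 * ρ⁻¹ * ‖lam‖ ^ 2 : ℝ) : EReal) := by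
    funext x
    rw [augLagrangian, hecoe, EReal.coe_sub, EReal.coe_add]
  have haugR : (fun x => (augLagrangian φ Φ g x lam ρ).toReal) = fun x =>
      φ x + e (Φ x + ρ⁻¹ • lam) - 1 / 2 * ρ⁻¹ * ‖lam‖ ^ 2 := by
    funext x
    rw [congrFun haug x, EReal.toReal_coe]
  have hgradL := hasGradientAt_add_comp (1 / 2 * ρ⁻¹ * ‖lam‖ ^ 2)
    (hφ.differentiable (by norm_num) xbar) (hΦ.differentiable (by norm_num) xbar) hgrad
  have hv' : v = gradient (fun x => lagrangian φ Φ x μ) xbar := by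
    rw [hv, haugR]
    exact hgradL.gradient
  have hmain := tendsto_secondDiffQuot_add_comp hφ hΦ (1 / 2 * ρ⁻¹ * ‖lam‖ ^ 2) hlim
  rw [← hv'] at hgradL hmain
  refine ⟨henv, fun x => ?_, hgrad.differentiableAt, ?_, ?_, ?_, fun w => ?_⟩
  · rw [congrFun haug x]
    exact ⟨EReal.coe_ne_bot _, EReal.coe_ne_top _⟩
  · rw [haugR]
    exact hgradL.differentiableAt
  · rw [haug]
    exact isTwiceSemidifferentiableAt_of_tendsto hgradL hmain
  · rw [haug]
    exact isTwiceEpiDifferentiableAt_of_tendsto (EReal.coe_ne_bot _) (EReal.coe_ne_top _) hmain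
  · rw [haug]
    exact (hmain w).liminf_eq
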